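/- A tropical meromorphic function is a continuous piecewise linear function $f:\mathbb R\to\mathbb R$ (arbitrary real slopes; locally finitely many break points). Put $\omega_f(x)=\lim_{\varepsilon\to0+}\bigl(f'(x+\varepsilon)-f'(x-\varepsilon)\bigr)$. The point $x$ is a pole of $f$ if $\omega_f(x)<0$ and a root of $f$ if $\omega_f(x)>0$, in both cases of multiplicity $|\omega_f(x)|$. For $r>0$ let $$m(r,f)=\tfrac12\bigl(f^+(r)+f^+(-r)\bigr),\qquad N(r,f)=\tfrac12\int_0^r n(t,f)\,dt,\qquad T(r,f)=m(r,f)+N(r,f),$$ where $f^+=\max(f,0)$ and $n(t,f)$ is the number of poles of $f$ in $(-t,t)$ counted with multiplicity. Let $\rho_2=\limsup_{r\to\infty}\frac{\log\log T(r,f)}{\log r}$ be the hyper-order of $f$, and put $$L_f=\inf\{f(b):\omega_f(b)<0\},\qquad \ell_f=\inf\{f(a):\omega_f(a)>0\},\qquad \inf\emptyset=+\infty.$$ Write $1_\circ\oslash(f\oplus a)$ for the function $x\mapsto-\max(f(x),a)$. A measurable set $E\subset[1,\infty)$ has finite logarithmic measure if $\int_E dr/r<\infty$. **Corollary.** Suppose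 $f$ is a nonconstant tropical meromorphic function of hyper-order $\rho_2<1$, let $0<\delta<1-\rho_2$, and suppose $\ell_f>-\infty$. 1. If $q\ge1$ and $a_1,\dots,a_q\in\mathbb R$ are distinct with $\max(a_1,\dots,a_q)<L_f$, then $$q\,T(r,f)\le\sum_{j=1}^qN\bigl(r,1_\circ\oslash(f\oplus a_j)\bigr)+o\bigl(T(r,f)/r^\delta\bigr)$$ as $r\to\infty$ outside a set of finite logarithmic measure. 2. In particular, for every real $a<L_f$, $$T(r,f)\le N\bigl(r,1_\circ\oslash(f\oplus a)\bigr)+o\bigl(T(r,f)/r^\delta\bigr)$$ as $r\to\infty$ outside a set of finite logarithmic measure. 3. Consequently $f$ has no deficient values below $L_f$: for every real $a<L_f$, $$1-\limsup_{r\to\infty}\frac{N\bigl(r,1_\circ\oslash(f\oplus a)\bigr)}{T(r,f)}=0.$$ -/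

import Mathlib

open Filter Topology MeasureTheory Set Asymptotics

namespace TropNev

noncomputable section

/-- Tropical addition `x ⊕ y = max x y` on the reals. -/
def tadd (x y : ℝ) : ℝ := max x y

/-- Tropical division `x ⊘ y = x - y` on the reals. -/
def tdiv (x y : ℝ) : ℝ := x - y

/-- The tropical multiplicative unit `1∘ = 0`. -/
def tone : ℝ := 0

/-- A tropical meromorphic function: a continuous piecewise linear function `ℝ → ℝ` with arbitrary
real slopes. The set `S` of break points is locally finite, and `f` is affine on every open interval
that contains no break point. -/
structure IsTropicalMeromorphic (f : ℝ → ℝ) : Prop where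
  continuous : Continuous f
  piecewise_linear : ∃ S : Set ℝ, (∀ R : ℝ, (S ∩ Icc (-R) R).Finite) ∧
    ∀ u v : ℝ, u < v → Disjoint (Ioo u v) S →
      ∃ m b : ℝ, ∀ x ∈ Ioo u v, f x = m * x + b

/-- `ω_f(x) = lim_{ε → 0+} (f'(x+ε) - f'(x-ε))`, the jump of the slope at `x`. For a tropical
meromorphic function this limit exists at every point. -/
def omega (f : ℝ → ℝ) (x : ℝ) : ℝ :=
  limUnder (𝓝[>] (0 : ℝ)) (fun ε : ℝ => deriv f (x + ε) - deriv f (x - ε))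

/-- The poles of `f`. -/
def poles (f : ℝ → ℝ) : Set ℝ := {x | omega f x < 0}

/-- The roots of `f`. -/
def roots (f : ℝ → ℝ) : Set ℝ := {x | 0 < omega f x}

/-- The multiplicity `τ_f(x)` of a pole or a root `x` of `f`. -/
def multiplicity (f : ℝ → ℝ) (x : ℝ) : ℝ := |omega f x|

/-- The proximity function `m(r, f) = (f⁺(r) + f⁺(-r)) / 2`. -/
def proximity (r : ℝ) (f : ℝ → ℝ) : ℝ := (max (f r) 0 + max (f (-r)) 0) / 2

/-- `n(r, f)`: the number of poles of `f` in `(-r, r)`, counted with multiplicity. -/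
def poleCount (r : ℝ) (f : ℝ → ℝ) : ℝ := ∑ᶠ b ∈ poles f ∩ Ioo (-r) r, multiplicity f b

/-- The counting function `N(r, f) = (1/2) ∫_0^r n(t, f) dt`. -/
def counting (r : ℝ) (f : ℝ → ℝ) : ℝ := (1 / 2) * ∫ t in (0 : ℝ)..r, poleCount t f

/-- The characteristic function `T(r, f) = m(r, f) + N(r, f)`. -/
def characteristic (r : ℝ) (f : ℝ → ℝ) : ℝ := proximity r f + counting r f

/-- The hyper-order `ρ₂(f) = limsup_{r → ∞} log log T(r, f) / log r`, an extended real. -/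
def hyperOrder (f : ℝ → ℝ) : EReal :=
  limsup (fun r : ℝ =>
    ((Real.log (Real.log (characteristic r f)) / Real.log r : ℝ) : EReal)) atTop

/-- `L_f`: the infimum of `f` over its poles, `+∞` if there are none. -/
def poleInf (f : ℝ → ℝ) : EReal := ⨅ b ∈ poles f, (f b : EReal)

/-- `ℓ_f`: the infimum of `f` over its roots, `+∞` if there are none. -/
def rootInf (f : ℝ → ℝ) : EReal := ⨅ a ∈ roots f, (f a : EReal)

/-- The function `1∘ ⊘ (f ⊕ a)`, that is, `x ↦ -max (f x) a`. -/
def recipAdd (f : ℝ → ℝ) (a : ℝ) : ℝ → ℝ := fun x => tdiv tone (tadd (f x) a)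

/-- The set `E` has finite logarithmic measure: `∫_E dr / r < ∞`. -/
def HasFiniteLogMeasure (E : Set ℝ) : Prop :=
  MeasurableSet E ∧ E ⊆ Ici 1 ∧ ∫⁻ r in E, ENNReal.ofReal r⁻¹ < ⊤

/-- The deficiency `1 - limsup_{r → ∞} N(r, 1∘ ⊘ (f ⊕ a)) / T(r, f)` of the value `a`. The value `a`
is deficient when this is nonzero. -/
def deficiency (f : ℝ → ℝ) (a : ℝ) : EReal :=
  1 - limsup (fun r : ℝ =>
    ((counting r (recipAdd f a) / characteristic r f : ℝ) : EReal)) atTop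

end

end TropNev

/-!
For `a < L_f` put `g = max f a`. Every pole `b` of `f` has `f b > a`, so `g = f` near `b`; at a point
where `f = a` the function `g` has a local minimum, and where `f < a` it is locally constant. Hence
`g` and `f` have the same poles with the same multiplicities, and `N(r, g) = N(r, f)`. The tropical
Jensen formula for `g` then reads
`N(r, -g) = N(r, f) + (g(r) + g(-r)) / 2 - g(0)`,
and since `g` and `f⁺` differ by at most `|a|`, the right-hand side is `T(r, f) + O(1)`
(`abs_counting_recipAdd_sub_characteristic_le`).

A bounded error is small enough: Jensen's formula also shows that the characteristic of a nonconstant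
function grows at least linearly (`exists_linear_le_characteristic`). Therefore the hyper-order is
nonnegative, `δ < 1`, and `T(r, f) / r ^ δ → ∞`. So all the estimates hold with an empty
exceptional set and a constant error term.

Jensen's formula itself comes from the representation of `f` on a bounded interval as an affine
function plus a finite combination `∑ ω_f(s) max(x - s, 0)` of ramps
(`exists_affine_add_sum_ramp`). It is derived from `HasSlopes`, a pointwise description of piecewise
linearity that is stable under linear combinations and under `max`.
-/

open Filter Topology MeasureTheory Set Asymptotics

namespace TropNev

/-! ### One-sided slopes -/

/-- Near `x` the function `f` is affine of slope `m₁` on the left of `x` and affine of slope `m₂` on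
the right, and continuous at `x`. Writing the two branches with `min` and `max` makes the condition
linear in `(f, m₁, m₂)`. -/
def HasSlopes (f : ℝ → ℝ) (x m₁ m₂ : ℝ) : Prop :=
  ∀ᶠ y in 𝓝 x, f y = f x + m₁ * min (y - x) 0 + m₂ * max (y - x) 0

namespace HasSlopes

variable {f g : ℝ → ℝ} {x m₁ m₂ n₁ n₂ : ℝ}

lemma congr (hf : HasSlopes f x m₁ m₂) (h : g =ᶠ[𝓝 x] f) : HasSlopes g x m₁ m₂ := by
  filter_upwards [hf, h] with y hy hgy
  rw [hgy, h.self_of_nhds, hy]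

lemma continuousAt (hf : HasSlopes f x m₁ m₂) : ContinuousAt f x := by
  have h : Tendsto (fun y => f x + m₁ * min (y - x) 0 + m₂ * max (y - x) 0) (𝓝 x)
      (𝓝 (f x + m₁ * min (x - x) 0 + m₂ * max (x - x) 0)) :=
    Continuous.tendsto (by fun_prop) x
  simp only [sub_self, min_self, max_self, mul_zero, add_zero] at h
  exact h.congr' (hf.mono fun y hy => hy.symm)

lemma of_affine (c m b : ℝ) (h : ∀ᶠ y in 𝓝 c, f y = m * y + b) : HasSlopes f c m m := by
  filter_upwards [h] with y hy
  rw [hy, h.self_of_nhds]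
  rcases le_total (y - c) 0 with h0 | h0
  · rw [min_eq_left h0, max_eq_right h0]; ring
  · rw [min_eq_right h0, max_eq_left h0]; ring

lemma eventually_affine (hf : HasSlopes f x m₁ m₁) :
    ∀ᶠ y in 𝓝 x, f y = m₁ * y + (f x - m₁ * x) := by
  filter_upwards [hf] with y hy
  rw [hy]
  linear_combination m₁ * min_add_max (y - x) 0

lemma neg (hf : HasSlopes f x m₁ m₂) : HasSlopes (fun y => -f y) x (-m₁) (-m₂) := by
  filter_upwards [hf] with y hy
  rw [hy]; ring

lemma sub (hf : HasSlopes f x m₁ m₂) (hg : HasSlopes g x n₁ n₂) :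
    HasSlopes (fun y => f y - g y) x (m₁ - n₁) (m₂ - n₂) := by
  filter_upwards [hf, hg] with y hy hgy
  rw [hy, hgy]; ring

lemma const_mul (c : ℝ) (hf : HasSlopes f x m₁ m₂) :
    HasSlopes (fun y => c * f y) x (c * m₁) (c * m₂) := by
  filter_upwards [hf] with y hy
  rw [hy]; ring

lemma sum {A : Finset ℝ} {F : ℝ → ℝ → ℝ} {p q : ℝ → ℝ}
    (h : ∀ s ∈ A, HasSlopes (F s) x (p s) (q s)) :
    HasSlopes (fun y => ∑ s ∈ A, F s y) x (∑ s ∈ A, p s) (∑ s ∈ A, q s) := by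
  have h' := (Filter.eventually_all_finset A).2 h
  filter_upwards [h'] with y hy
  rw [Finset.sum_mul, Finset.sum_mul, ← Finset.sum_add_distrib, ← Finset.sum_add_distrib]
  exact Finset.sum_congr rfl hy

lemma ramp (s x : ℝ) :
    HasSlopes (fun y => max (y - s) 0) x (if s < x then 1 else 0) (if s ≤ x then 1 else 0) := by
  rcases lt_trichotomy s x with h | rfl | h
  · rw [if_pos h, if_pos h.le]
    refine of_affine x 1 (-s) ?_
    filter_upwards [lt_mem_nhds h] with y hy
    rw [max_eq_left (by linarith)]; ring
  · refine Eventually.of_forall fun y => ?_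
    simp
  · rw [if_neg h.not_gt, if_neg h.not_ge]
    refine of_affine x 0 0 ?_
    filter_upwards [gt_mem_nhds h] with y hy
    rw [max_eq_right (by linarith)]; ring

/-- At a point where `f` takes the value of the truncation level, the slope jump of the truncation is
nonnegative. -/
lemma max_const_of_eq (hf : HasSlopes f x m₁ m₂) :
    HasSlopes (fun y => max (f y) (f x)) x (min m₁ 0) (max m₂ 0) := by
  filter_upwards [hf] with y hy
  rw [hy, max_self]
  rcases le_total (y - x) 0 with h0 | h0
  · rw [min_eq_left h0, max_eq_right h0]
    rcases le_total m₁ 0 with h1 | h1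
    · rw [min_eq_left h1, max_eq_left (by nlinarith)]; ring
    · rw [min_eq_right h1, max_eq_right (by nlinarith)]; ring
  · rw [min_eq_right h0, max_eq_left h0]
    rcases le_total m₂ 0 with h1 | h1
    · rw [max_eq_right h1, max_eq_right (by nlinarith)]; ring
    · rw [max_eq_left h1, max_eq_left (by nlinarith)]; ring

lemma eventually_right (hf : HasSlopes f x m₁ m₂) : ∀ᶠ z in 𝓝[>] x, HasSlopes f z m₂ m₂ := by
  filter_upwards [nhdsWithin_le_nhds (eventually_eventually_nhds.2 hf), self_mem_nhdsWithin]
    with z hz hxz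
  refine of_affine z m₂ (f x - m₂ * x) ?_
  filter_upwards [hz, lt_mem_nhds hxz] with y hy hxy
  rw [hy, min_eq_right (by linarith), max_eq_left (by linarith)]; ring

lemma eventually_left (hf : HasSlopes f x m₁ m₂) : ∀ᶠ z in 𝓝[<] x, HasSlopes f z m₁ m₁ := by
  filter_upwards [nhdsWithin_le_nhds (eventually_eventually_nhds.2 hf), self_mem_nhdsWithin]
    with z hz hxz
  refine of_affine z m₁ (f x - m₁ * x) ?_
  filter_upwards [hz, gt_mem_nhds hxz] with y hy hxy
  rw [hy, min_eq_left (by linarith), max_eq_right (by linarith)]; ring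

lemma hasDerivAt (hf : HasSlopes f x m₁ m₁) : HasDerivAt f m₁ x := by
  have h : HasDerivAt (fun y => m₁ * y + (f x - m₁ * x)) m₁ x := by
    simpa using ((hasDerivAt_id x).const_mul m₁).add_const (f x - m₁ * x)
  exact h.congr_of_eventuallyEq hf.eventually_affine

lemma omega_eq (hf : HasSlopes f x m₁ m₂) : omega f x = m₂ - m₁ := by
  refine Tendsto.limUnder_eq (tendsto_const_nhds.congr' ?_)
  have hr : Tendsto (fun ε : ℝ => x + ε) (𝓝[>] 0) (𝓝[>] x) := by
    refine tendsto_nhdsWithin_iff.2 ⟨?_, ?_⟩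
    · have : Tendsto (fun ε : ℝ => x + ε) (𝓝 0) (𝓝 (x + 0)) := Continuous.tendsto (by fun_prop) 0
      rw [add_zero] at this
      exact this.mono_left nhdsWithin_le_nhds
    · filter_upwards [self_mem_nhdsWithin] with ε hε
      exact lt_add_of_pos_right x hε
  have hl : Tendsto (fun ε : ℝ => x - ε) (𝓝[>] 0) (𝓝[<] x) := by
    refine tendsto_nhdsWithin_iff.2 ⟨?_, ?_⟩
    · have : Tendsto (fun ε : ℝ => x - ε) (𝓝 0) (𝓝 (x - 0)) := Continuous.tendsto (by fun_prop) 0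
      rw [sub_zero] at this
      exact this.mono_left nhdsWithin_le_nhds
    · filter_upwards [self_mem_nhdsWithin] with ε hε
      exact sub_lt_self x hε
  filter_upwards [hr.eventually hf.eventually_right, hl.eventually hf.eventually_left] with ε h1 h2
  rw [h1.hasDerivAt.deriv, h2.hasDerivAt.deriv]

end HasSlopes

lemma IsTropicalMeromorphic.hasSlopes {f : ℝ → ℝ} (hf : IsTropicalMeromorphic f) (x : ℝ) :
    ∃ m₁ m₂, HasSlopes f x m₁ m₂ := by
  obtain ⟨S, hS, haff⟩ := hf.piecewise_linear
  have hfin : ((S ∩ Icc (-(|x| + 1)) (|x| + 1)) \ {x}).Finite := (hS _).subset sdiff_subset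
  have hnhds : ((S ∩ Icc (-(|x| + 1)) (|x| + 1)) \ {x})ᶜ ∈ 𝓝 x :=
    hfin.isClosed.isOpen_compl.mem_nhds (by simp)
  obtain ⟨e, he, hball⟩ := Metric.mem_nhds_iff.1 hnhds
  obtain ⟨d, hd0, hde, hd1⟩ : ∃ d, 0 < d ∧ d ≤ e ∧ d ≤ 1 :=
    ⟨min e 1, lt_min he one_pos, min_le_left _ _, min_le_right _ _⟩
  have key : ∀ y, y ≠ x → |y - x| < d → y ∉ S := by
    intro y hyx hyd hyS
    refine hball (Metric.mem_ball.2 (by rw [Real.dist_eq]; linarith)) ⟨⟨hyS, ?_⟩, hyx⟩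
    have := abs_lt.1 hyd
    constructor <;> linarith [neg_abs_le x, le_abs_self x]
  obtain ⟨m₂, b₂, h₂⟩ := haff x (x + d) (by linarith) (Set.disjoint_left.2 fun y hy =>
    key y hy.1.ne' (by rw [abs_lt]; constructor <;> linarith [hy.1, hy.2]))
  obtain ⟨m₁, b₁, h₁⟩ := haff (x - d) x (by linarith) (Set.disjoint_left.2 fun y hy =>
    key y hy.2.ne (by rw [abs_lt]; constructor <;> linarith [hy.1, hy.2]))
  -- By continuity both affine formulas persist up to the point `x` itself.
  have h₂' : EqOn f (fun y => m₂ * y + b₂) (Icc x (x + d)) := by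
    rw [← closure_Ioo (by linarith : x ≠ x + d)]
    exact Set.EqOn.closure h₂ hf.continuous (by fun_prop)
  have h₁' : EqOn f (fun y => m₁ * y + b₁) (Icc (x - d) x) := by
    rw [← closure_Ioo (by linarith : x - d ≠ x)]
    exact Set.EqOn.closure h₁ hf.continuous (by fun_prop)
  refine ⟨m₁, m₂, ?_⟩
  filter_upwards [Icc_mem_nhds (by linarith : x - d < x) (by linarith : x < x + d)] with y hy
  rcases le_total y x with h | h
  · rw [h₁' ⟨hy.1, h⟩, h₁' ⟨by linarith, le_rfl⟩, min_eq_left (by linarith),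
      max_eq_right (by linarith)]
    ring
  · rw [h₂' ⟨h, hy.2⟩, h₂' ⟨le_rfl, by linarith⟩, min_eq_right (by linarith),
      max_eq_left (by linarith)]
    ring

/-! ### The representation by ramps and Jensen's formula -/

/-- A function without slope jumps on a preconnected open set is affine there. -/
lemma exists_affine_of_hasSlopes {g : ℝ → ℝ} {U : Set ℝ} (hU : IsOpen U) (hU' : IsPreconnected U)
    (h : ∀ x ∈ U, ∃ m, HasSlopes g x m m) : ∃ m b, ∀ x ∈ U, g x = m * x + b := by
  -- The derivative is locally constant, hence constant.
  have hd : ∀ x ∈ U, HasDerivAt (deriv g) 0 x := by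
    intro x hx
    obtain ⟨m, hm⟩ := h x hx
    refine (hasDerivAt_const x m).congr_of_eventuallyEq ?_
    filter_upwards [eventually_eventually_nhds.2 hm.eventually_affine] with y hy
    exact (HasSlopes.of_affine y _ _ hy).hasDerivAt.deriv
  obtain ⟨m, hm⟩ := hU.exists_is_const_of_deriv_eq_zero hU'
    (fun x hx => (hd x hx).differentiableAt.differentiableWithinAt) (fun x hx => (hd x hx).deriv)
  have hd' : ∀ x ∈ U, HasDerivAt (fun y => g y - m * y) 0 x := by
    intro x hx
    obtain ⟨m', hm'⟩ := h x hx
    have h1 := hm'.hasDerivAt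
    rw [← h1.deriv, hm x hx] at h1
    have h2 := h1.fun_sub ((hasDerivAt_id x).const_mul m)
    rw [mul_one, sub_self] at h2
    exact h2
  obtain ⟨b, hb⟩ := hU.exists_is_const_of_deriv_eq_zero hU'
    (fun x hx => (hd' x hx).differentiableAt.differentiableWithinAt) (fun x hx => (hd' x hx).deriv)
  exact ⟨m, b, fun x hx => by linarith [hb x hx]⟩

lemma finite_omega_ne_zero {f : ℝ → ℝ} (hf : ∀ x, ∃ m₁ m₂, HasSlopes f x m₁ m₂)
    (R : ℝ) : ({x | omega f x ≠ 0} ∩ Icc (-R) R).Finite := by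
  have hloc : ∀ x ∈ Icc (-R) R, {y | omega f y ≠ 0 → y = x} ∈ 𝓝 x := by
    intro x _
    obtain ⟨m₁, m₂, h⟩ := hf x
    have hr := eventually_nhdsWithin_iff.1 h.eventually_right
    have hl := eventually_nhdsWithin_iff.1 h.eventually_left
    filter_upwards [hr, hl] with y h1 h2 hy
    by_contra hne
    rcases lt_or_gt_of_ne hne with hlt | hgt
    · exact hy (by rw [(h2 hlt).omega_eq, sub_self])
    · exact hy (by rw [(h1 hgt).omega_eq, sub_self])
  obtain ⟨t, -, ht⟩ := isCompact_Icc.elim_nhds_subcover _ hloc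
  refine t.finite_toSet.subset fun y hy => ?_
  obtain ⟨x, hxt, hx⟩ := mem_iUnion₂.1 (ht hy.2)
  rw [hx hy.1]
  exact hxt

lemma exists_finset_omega {f : ℝ → ℝ} (hf : ∀ x, ∃ m₁ m₂, HasSlopes f x m₁ m₂)
    (R : ℝ) :
    ∃ A : Finset ℝ, ∀ x, |x| < R → omega f x ≠ 0 → x ∈ A :=
  ⟨(finite_omega_ne_zero hf R).toFinset, fun x hx h0 => by
    rw [Set.Finite.mem_toFinset]
    exact ⟨h0, (abs_le.1 hx.le)⟩⟩

lemma exists_affine_add_sum_ramp {f : ℝ → ℝ} (hf : ∀ x, ∃ m₁ m₂, HasSlopes f x m₁ m₂)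
    {R : ℝ} {A : Finset ℝ}
    (hA : ∀ x, |x| < R → omega f x ≠ 0 → x ∈ A) :
    ∃ m b, ∀ x, |x| < R → f x = m * x + b + ∑ s ∈ A, omega f s * max (x - s) 0 := by
  have hslope : ∀ x ∈ Ioo (-R) R,
      ∃ m, HasSlopes (fun y => f y - ∑ s ∈ A, omega f s * max (y - s) 0) x m m := by
    intro x hx
    obtain ⟨m₁, m₂, h⟩ := hf x
    have hsum := HasSlopes.sum (A := A) fun s _ => (HasSlopes.ramp s x).const_mul (omega f s)
    have hdiff := h.sub hsum
    -- The jumps of the ramps at `x` add up to the jump of `f`.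
    have hjump : ∑ s ∈ A, omega f s * (if s ≤ x then 1 else 0)
        - ∑ s ∈ A, omega f s * (if s < x then 1 else 0) = omega f x := by
      rw [← Finset.sum_sub_distrib]
      calc _ = ∑ s ∈ A, (if s = x then omega f s else 0) := by
            refine Finset.sum_congr rfl fun s _ => ?_
            rcases lt_trichotomy s x with h | h | h
            · simp [h, h.le, h.ne]
            · simp [h]
            · simp [h.not_gt, h.not_ge, h.ne']
        _ = omega f x := by
            rw [Finset.sum_ite_eq' A x]
            split_ifs with hxA
            · rfl
            · by_contra h0
              exact hxA (hA x (abs_lt.2 hx) (Ne.symm h0))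
    exact ⟨_, (by linarith [h.omega_eq] : m₁ - ∑ s ∈ A, omega f s * (if s < x then 1 else 0)
      = m₂ - ∑ s ∈ A, omega f s * (if s ≤ x then 1 else 0)) ▸ hdiff⟩
  obtain ⟨m, b, h⟩ := exists_affine_of_hasSlopes isOpen_Ioo isPreconnected_Ioo hslope
  exact ⟨m, b, fun x hx => by linarith [h x (abs_lt.1 hx)]⟩

/-- The tropical Jensen formula, before the sum over the slope jumps is split into the contributions
of roots and of poles. -/
lemma jensen_sum {f : ℝ → ℝ} (hf : ∀ x, ∃ m₁ m₂, HasSlopes f x m₁ m₂)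
    {r : ℝ} (hr : 0 < r) {A : Finset ℝ}
    (hA : ∀ x, |x| < r + 1 → omega f x ≠ 0 → x ∈ A) :
    f r + f (-r) - 2 * f 0 = ∑ s ∈ A, omega f s * max (r - |s|) 0 := by
  obtain ⟨m, b, h⟩ := exists_affine_add_sum_ramp hf hA
  rw [h r (by rw [abs_of_pos hr]; linarith), h (-r) (by rw [abs_neg, abs_of_pos hr]; linarith),
    h 0 (by rw [abs_zero]; linarith)]
  have hsum : ∑ s ∈ A, omega f s * max (r - |s|) 0 = ∑ s ∈ A, omega f s * max (r - s) 0
      + ∑ s ∈ A, omega f s * max (-r - s) 0 - 2 * ∑ s ∈ A, omega f s * max (0 - s) 0 := by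
    rw [Finset.mul_sum, ← Finset.sum_add_distrib, ← Finset.sum_sub_distrib]
    refine Finset.sum_congr rfl fun s _ => ?_
    have : max (r - |s|) 0 = max (r - s) 0 + max (-r - s) 0 - 2 * max (0 - s) 0 := by
      rcases le_total 0 s with hs | hs
      · rw [abs_of_nonneg hs, max_eq_right (by linarith : -r - s ≤ 0),
          max_eq_right (by linarith : 0 - s ≤ 0)]
        ring
      · rw [abs_of_nonpos hs, max_eq_left (by linarith : 0 ≤ r - s),
          max_eq_left (by linarith : 0 ≤ 0 - s)]
        rcases le_total (r + s) 0 with h1 | h1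
        · rw [max_eq_right (by linarith), max_eq_left (by linarith)]; ring
        · rw [max_eq_left (by linarith), max_eq_right (by linarith)]; ring
    rw [this]; ring
  rw [hsum]; ring

lemma poleCount_eq_sum {f : ℝ → ℝ} {r t : ℝ} (htr : t ≤ r) {A : Finset ℝ}
    (hA : ∀ x, |x| < r → omega f x ≠ 0 → x ∈ A) :
    poleCount t f = ∑ s ∈ A, max (-omega f s) 0 * (if |s| < t then 1 else 0) := by
  classical
  have h1 : poleCount t f = ∑ᶠ s, max (-omega f s) 0 * (if |s| < t then 1 else 0) := by
    unfold poleCount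
    refine finsum_congr fun s => ?_
    by_cases hs : s ∈ poles f ∩ Ioo (-t) t
    · have hp : omega f s < 0 := hs.1
      rw [finsum_eq_if, if_pos hs, if_pos (abs_lt.2 hs.2), max_eq_left (by linarith), multiplicity,
        abs_of_neg hp, mul_one]
    · rw [finsum_eq_if, if_neg hs]
      by_cases hst : |s| < t
      · have : ¬ omega f s < 0 := fun h => hs ⟨h, abs_lt.1 hst⟩
        rw [max_eq_right (by linarith), zero_mul]
      · rw [if_neg hst, mul_zero]
  rw [h1]
  refine finsum_eq_finsetSum_of_support_subset _ fun s hs => ?_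
  by_cases hst : |s| < t
  · refine hA s (by linarith) fun h0 => ?_
    simp [h0] at hs
  · simp [hst] at hs

lemma integral_indicator_abs_lt {r : ℝ} (hr : 0 ≤ r) (s : ℝ) :
    IntervalIntegrable (fun t : ℝ => if |s| < t then (1 : ℝ) else 0) volume 0 r ∧
      ∫ t in (0 : ℝ)..r, (if |s| < t then (1 : ℝ) else 0) = max (r - |s|) 0 := by
  have heq : (fun t : ℝ => if |s| < t then (1 : ℝ) else 0) = (Ioi |s|).indicator 1 := by
    ext t; simp [indicator_apply]
  constructor
  · rw [heq, intervalIntegrable_iff_integrableOn_Ioc_of_le hr]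
    exact (integrableOn_const (by simp) : IntegrableOn (fun _ => (1 : ℝ)) (Ioc 0 r)).indicator
      measurableSet_Ioi
  · rw [heq, intervalIntegral.integral_of_le hr, integral_indicator_one measurableSet_Ioi,
      measureReal_restrict_apply measurableSet_Ioi]
    have : Ioi |s| ∩ Ioc 0 r = Ioc |s| r := by
      ext t
      simp only [mem_inter_iff, mem_Ioi, mem_Ioc]
      exact ⟨fun h => ⟨h.1, h.2.2⟩, fun h => ⟨h.1, (abs_nonneg s).trans_lt h.1, h.2⟩⟩
    rw [this, Measure.real, Real.volume_Ioc, ENNReal.toReal_ofReal']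

/-- The counting function as a finite sum over the poles. -/
lemma counting_eq_sum {f : ℝ → ℝ} {r : ℝ} (hr : 0 < r) {A : Finset ℝ}
    (hA : ∀ x, |x| < r → omega f x ≠ 0 → x ∈ A) :
    counting r f = 1 / 2 * ∑ s ∈ A, max (-omega f s) 0 * max (r - |s|) 0 := by
  unfold counting
  congr 1
  calc ∫ t in (0 : ℝ)..r, poleCount t f
      = ∫ t in (0 : ℝ)..r, ∑ s ∈ A, max (-omega f s) 0 * (if |s| < t then 1 else 0) := by
        refine intervalIntegral.integral_congr fun t ht => ?_
        rw [uIcc_of_le hr.le] at ht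
        exact poleCount_eq_sum ht.2 hA
    _ = _ := by
        rw [intervalIntegral.integral_finsetSum
          fun s _ => (integral_indicator_abs_lt hr.le s).1.const_mul _]
        refine Finset.sum_congr rfl fun s _ => ?_
        rw [intervalIntegral.integral_const_mul, (integral_indicator_abs_lt hr.le s).2]

lemma omega_neg {f : ℝ → ℝ} (hf : ∀ x, ∃ m₁ m₂, HasSlopes f x m₁ m₂) (x : ℝ) :
    omega (fun y => -f y) x = -omega f x := by
  obtain ⟨m₁, m₂, h⟩ := hf x
  rw [h.omega_eq, h.neg.omega_eq]; ring

/-- The tropical Jensen formula. -/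
lemma jensen {f : ℝ → ℝ} (hf : ∀ x, ∃ m₁ m₂, HasSlopes f x m₁ m₂) {r : ℝ} (hr : 0 < r) :
    counting r (fun x => -f x) = counting r f + (f r + f (-r)) / 2 - f 0 := by
  obtain ⟨A, hA⟩ := exists_finset_omega hf (r + 1)
  have hA' : ∀ x, |x| < r → omega f x ≠ 0 → x ∈ A := fun x hx => hA x (by linarith)
  have hJ := jensen_sum hf hr hA
  rw [counting_eq_sum hr hA', counting_eq_sum (A := A) hr fun x hx h0 => hA' x hx fun h => h0 (by
    rw [omega_neg hf, h, neg_zero])]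
  have : ∑ s ∈ A, omega f s * max (r - |s|) 0
      = ∑ s ∈ A, max (-omega (fun x => -f x) s) 0 * max (r - |s|) 0
        - ∑ s ∈ A, max (-omega f s) 0 * max (r - |s|) 0 := by
    rw [← Finset.sum_sub_distrib]
    refine Finset.sum_congr rfl fun s _ => ?_
    rw [omega_neg hf, neg_neg, ← sub_mul]
    congr 1
    rcases le_total (omega f s) 0 with h | h
    · rw [max_eq_right h, max_eq_left (by linarith)]; ring
    · rw [max_eq_left h, max_eq_right (by linarith)]; ring
  linarith

/-! ### Linear growth of the characteristic function -/

/-- A pole makes the counting function grow linearly. Without poles the proximity function does: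
by Jensen's formula if there is a root, and because `f` is affine if there is none. -/
lemma exists_linear_le_characteristic {f : ℝ → ℝ} (hf : ∀ x, ∃ m₁ m₂, HasSlopes f x m₁ m₂)
    (hnc : ¬ ∃ c : ℝ, ∀ x : ℝ, f x = c) :
    ∃ c > 0, ∃ C, ∀ r > 0, c * r - C ≤ characteristic r f := by
  have hprox : ∀ r, 0 ≤ proximity r f := fun r => by unfold proximity; positivity
  have hcount : ∀ r > 0, 0 ≤ counting r f := by
    intro r hr
    obtain ⟨A, hA⟩ := exists_finset_omega hf r
    rw [counting_eq_sum hr hA]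
    positivity
  by_cases hpole : ∃ b, omega f b < 0
  · obtain ⟨b, hb⟩ := hpole
    refine ⟨-omega f b / 2, by linarith, -omega f b / 2 * |b|, fun r hr => ?_⟩
    obtain ⟨A, hA⟩ := exists_finset_omega hf (max r (|b| + 1))
    have hbA : b ∈ A := hA b (lt_max_of_lt_right (by linarith)) hb.ne
    have h1 := Finset.single_le_sum (f := fun s => max (-omega f s) 0 * max (r - |s|) 0)
      (fun s _ => by positivity) hbA
    have h2 := counting_eq_sum hr fun x hx => hA x (lt_max_of_lt_left hx)
    have h3 : -omega f b * (r - |b|) ≤ max (-omega f b) 0 * max (r - |b|) 0 := by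
      rw [max_eq_left (by linarith : 0 ≤ -omega f b)]
      exact mul_le_mul_of_nonneg_left (le_max_left _ _) (by linarith)
    have := hprox r
    unfold characteristic
    nlinarith
  have hpole' : ∀ x, 0 ≤ omega f x := fun x => not_lt.1 fun h => hpole ⟨x, h⟩
  by_cases hroot : ∃ b, 0 < omega f b
  · -- Without poles `f` is convex, and Jensen's formula bounds the proximity function from below.
    obtain ⟨b, hb⟩ := hroot
    refine ⟨omega f b / 2, by linarith, omega f b / 2 * |b| - f 0, fun r hr => ?_⟩
    obtain ⟨A, hA⟩ := exists_finset_omega hf (max (r + 1) (|b| + 1))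
    have hbA : b ∈ A := hA b (lt_max_of_lt_right (by linarith)) hb.ne'
    have h1 := Finset.single_le_sum (f := fun s => omega f s * max (r - |s|) 0)
      (fun s _ => mul_nonneg (hpole' s) (le_max_right _ _)) hbA
    have h2 := jensen_sum hf hr fun x hx => hA x (lt_max_of_lt_left hx)
    have h3 : omega f b * (r - |b|) ≤ omega f b * max (r - |b|) 0 :=
      mul_le_mul_of_nonneg_left (le_max_left _ _) hb.le
    have := hcount r hr
    have h4 := le_max_left (f r) 0
    have h5 := le_max_left (f (-r)) 0
    unfold characteristic proximity
    nlinarith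
  · -- Without roots and poles `f` is affine.
    have hzero : ∀ x, omega f x = 0 := fun x =>
      le_antisymm (not_lt.1 fun h => hroot ⟨x, h⟩) (hpole' x)
    obtain ⟨m, b, h⟩ := exists_affine_of_hasSlopes (g := f) isOpen_univ isPreconnected_univ
      fun x _ => by
        obtain ⟨m₁, m₂, h⟩ := hf x
        have : m₂ = m₁ := by linarith [h.omega_eq, hzero x]
        exact ⟨m₁, this ▸ h⟩
    have hm : m ≠ 0 := fun hm => hnc ⟨b, fun x => by rw [h x (mem_univ x), hm]; ring⟩
    refine ⟨|m| / 2, by positivity, -b / 2, fun r hr => ?_⟩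
    have := hcount r hr
    have h4 := le_max_left (f r) 0
    have h5 := le_max_left (f (-r)) 0
    have h4' := le_max_right (f r) 0
    have h5' := le_max_right (f (-r)) 0
    have e1 := h r (mem_univ r)
    have e2 := h (-r) (mem_univ _)
    unfold characteristic proximity
    rcases abs_choice m with hm | hm <;> rw [hm] <;> nlinarith

lemma tendsto_characteristic_div_rpow {f : ℝ → ℝ} {c C δ : ℝ} (hc : 0 < c) (hδ : δ < 1)
    (h : ∀ r > 0, c * r - C ≤ characteristic r f) :
    Tendsto (fun r => characteristic r f / r ^ δ) atTop atTop := by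
  have hlin : ∀ᶠ r : ℝ in atTop, c / 2 * r ^ (1 - δ) ≤ characteristic r f / r ^ δ := by
    filter_upwards [eventually_gt_atTop 0, eventually_ge_atTop (2 * C / c)] with r hr hr'
    rw [div_le_iff₀ hc] at hr'
    rw [le_div_iff₀ (by positivity), mul_assoc, ← Real.rpow_add hr, sub_add_cancel, Real.rpow_one]
    linarith [h r hr]
  exact tendsto_atTop_mono' _ hlin
    ((tendsto_rpow_atTop (by linarith : 0 < 1 - δ)).const_mul_atTop (by positivity))

lemma tendsto_characteristic {f : ℝ → ℝ} {c C : ℝ} (hc : 0 < c)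
    (h : ∀ r > 0, c * r - C ≤ characteristic r f) :
    Tendsto (fun r => characteristic r f) atTop atTop := by
  simpa using tendsto_characteristic_div_rpow hc one_pos h

lemma hyperOrder_nonneg {f : ℝ → ℝ} (h : Tendsto (fun r => characteristic r f) atTop atTop) :
    0 ≤ hyperOrder f := by
  refine le_limsup_of_frequently_le' (Eventually.frequently ?_)
  have hT := Real.tendsto_log_atTop.comp (Real.tendsto_log_atTop.comp h)
  filter_upwards [hT.eventually_ge_atTop 0, eventually_ge_atTop 1] with r h1 h2
  exact EReal.coe_nonneg.2 (div_nonneg h1 (Real.log_nonneg h2))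

/-! ### Values below the poles -/

/-- The slope jump of `max f a` is that of `f` above the level `a`, and nonnegative elsewhere. -/
lemma exists_hasSlopes_max {f : ℝ → ℝ} (hf : ∀ x, ∃ m₁ m₂, HasSlopes f x m₁ m₂) (a x : ℝ) :
    ∃ m₁ m₂, HasSlopes (fun y => max (f y) a) x m₁ m₂ ∧ (a < f x → m₂ - m₁ = omega f x) ∧
      (f x ≤ a → m₁ ≤ m₂) := by
  obtain ⟨m₁, m₂, h⟩ := hf x
  rcases lt_trichotomy (f x) a with hlt | rfl | hgt
  · refine ⟨0, 0, HasSlopes.of_affine x 0 a ?_, fun h => absurd h hlt.not_gt, fun _ => le_rfl⟩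
    filter_upwards [h.continuousAt.eventually (gt_mem_nhds hlt)] with y hy
    rw [max_eq_right hy.le]; ring
  · exact ⟨_, _, h.max_const_of_eq, fun h => absurd h (lt_irrefl _),
      fun _ => (min_le_right _ _).trans (le_max_right _ _)⟩
  · refine ⟨m₁, m₂, h.congr ?_, fun _ => h.omega_eq.symm, fun h => absurd h hgt.not_ge⟩
    filter_upwards [h.continuousAt.eventually (lt_mem_nhds hgt)] with y hy
    exact max_eq_left hy.le

/-- Truncating `f` from below at a level under all its poles does not change the poles. -/
lemma counting_max_eq {f : ℝ → ℝ} (hf : ∀ x, ∃ m₁ m₂, HasSlopes f x m₁ m₂) {a : ℝ}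
    (ha : (a : EReal) < poleInf f) (r : ℝ) :
    counting r (fun y => max (f y) a) = counting r f := by
  have habove : ∀ b, omega f b < 0 → a < f b := fun b hb =>
    EReal.coe_lt_coe_iff.1 (ha.trans_le (iInf₂_le b hb))
  have hpoles : poles (fun y => max (f y) a) = poles f := by
    ext x
    obtain ⟨m₁, m₂, h, h1, h2⟩ := exists_hasSlopes_max hf a x
    simp only [poles, mem_ofPred_eq, h.omega_eq]
    rcases lt_or_ge a (f x) with hx | hx
    · rw [h1 hx]
    · exact ⟨fun h => absurd (h2 hx) (by linarith), fun h => absurd (habove x h) hx.not_gt⟩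
  have hmult : ∀ b ∈ poles f, multiplicity (fun y => max (f y) a) b = multiplicity f b := by
    intro b hb
    obtain ⟨m₁, m₂, h, h1, -⟩ := exists_hasSlopes_max hf a b
    rw [multiplicity, multiplicity, h.omega_eq, h1 (habove b hb)]
  have : ∀ t, poleCount t (fun y => max (f y) a) = poleCount t f := fun t => by
    unfold poleCount
    rw [hpoles]
    exact finsum_mem_congr rfl fun b hb => hmult b hb.1
  simp only [counting, this]

/-- For values below the poles the two sides of the second main theorem agree up to a bounded
error. -/
lemma abs_counting_recipAdd_sub_characteristic_le {f : ℝ → ℝ}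
    (hf : ∀ x, ∃ m₁ m₂, HasSlopes f x m₁ m₂) {a : ℝ} (ha : (a : EReal) < poleInf f) {r : ℝ}
    (hr : 0 < r) :
    |counting r (recipAdd f a) - characteristic r f| ≤ |a| + |max (f 0) a| := by
  have hg : ∀ x, ∃ m₁ m₂, HasSlopes (fun y => max (f y) a) x m₁ m₂ := fun x => by
    obtain ⟨m₁, m₂, h, -⟩ := exists_hasSlopes_max hf a x
    exact ⟨m₁, m₂, h⟩
  have hrecip : recipAdd f a = fun x => -max (f x) a := by
    ext x
    simp [recipAdd, tdiv, tone, tadd]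
  have hclose : ∀ x, |max (f x) a - max (f x) 0| ≤ |a| := fun x => by
    simpa using abs_max_sub_max_le_max (f x) a (f x) 0
  rw [hrecip, jensen hg hr, counting_max_eq hf ha]
  unfold characteristic proximity
  have h1 := abs_le.1 (hclose r)
  have h2 := abs_le.1 (hclose (-r))
  rw [abs_le]
  constructor <;> linarith [neg_abs_le (max (f 0) a), le_abs_self (max (f 0) a), h1.1, h1.2, h2.1,
    h2.2]

lemma hasFiniteLogMeasure_empty : HasFiniteLogMeasure ∅ :=
  ⟨MeasurableSet.empty, empty_subset _, by simp⟩

end TropNev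

theorem corollary5p3 (f : ℝ → ℝ) (hf : TropNev.IsTropicalMeromorphic f)
    (hnc : ¬ ∃ c : ℝ, ∀ x : ℝ, f x = c)
    (hρ : TropNev.hyperOrder f < 1)
    (δ : ℝ) (hδ0 : 0 < δ) (hδ : (δ : EReal) < 1 - TropNev.hyperOrder f)
    (hl : ⊥ < TropNev.rootInf f) :
    (∀ q : ℕ, 1 ≤ q → ∀ a : Fin q → ℝ, Function.Injective a →
      (∀ j, (a j : EReal) < TropNev.poleInf f) →
      ∃ E : Set ℝ, TropNev.HasFiniteLogMeasure E ∧ ∃ S : ℝ → ℝ,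
        S =o[atTop ⊓ 𝓟 Eᶜ] (fun r : ℝ => TropNev.characteristic r f / r ^ δ) ∧
        ∀ r : ℝ, 0 < r → r ∉ E →
          (q : ℝ) * TropNev.characteristic r f
            ≤ (∑ j, TropNev.counting r (TropNev.recipAdd f (a j))) + S r) ∧
    (∀ a : ℝ, (a : EReal) < TropNev.poleInf f →
      ∃ E : Set ℝ, TropNev.HasFiniteLogMeasure E ∧ ∃ S : ℝ → ℝ,
        S =o[atTop ⊓ 𝓟 Eᶜ] (fun r : ℝ => TropNev.characteristic r f / r ^ δ) ∧
        ∀ r : ℝ, 0 < r → r ∉ E →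
          TropNev.characteristic r f ≤ TropNev.counting r (TropNev.recipAdd f a) + S r) ∧
    (∀ a : ℝ, (a : EReal) < TropNev.poleInf f → TropNev.deficiency f a = 0) := by
  have hs := hf.hasSlopes
  obtain ⟨c, hc, C, hlin⟩ := TropNev.exists_linear_le_characteristic hs hnc
  have hT := TropNev.tendsto_characteristic hc hlin
  have hδ1 : δ < 1 := by
    have h0 := TropNev.hyperOrder_nonneg hT
    have h1 : (1 : EReal) - TropNev.hyperOrder f ≤ 1 - 0 := EReal.sub_le_sub le_rfl h0
    rw [sub_zero] at h1
    exact_mod_cast hδ.trans_le h1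
  have hsmall : ∀ K : ℝ, (fun _ : ℝ => K) =o[atTop ⊓ 𝓟 (∅ : Set ℝ)ᶜ]
      (fun r : ℝ => TropNev.characteristic r f / r ^ δ) := fun K => by
    refine IsLittleO.mono ?_ inf_le_left
    exact isLittleO_const_left.2 (Or.inr
      (tendsto_norm_atTop_atTop.comp (TropNev.tendsto_characteristic_div_rpow hc hδ1 hlin)))
  refine ⟨fun q _ a _ ha => ?_, fun a ha => ?_, fun a ha => ?_⟩
  · refine ⟨∅, TropNev.hasFiniteLogMeasure_empty, _,
      hsmall (∑ j, (|a j| + |max (f 0) (a j)|)), fun r hr _ => ?_⟩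
    rw [← Finset.sum_add_distrib]
    calc (q : ℝ) * TropNev.characteristic r f = ∑ _j : Fin q, TropNev.characteristic r f := by
          simp
      _ ≤ _ := Finset.sum_le_sum fun j _ => by
          linarith [(abs_le.1
            (TropNev.abs_counting_recipAdd_sub_characteristic_le hs (ha j) hr)).1]
  · refine ⟨∅, TropNev.hasFiniteLogMeasure_empty, _, hsmall (|a| + |max (f 0) a|),
      fun r hr _ => ?_⟩
    linarith [(abs_le.1 (TropNev.abs_counting_recipAdd_sub_characteristic_le hs ha hr)).1]
  · have hlim : Tendsto (fun r => TropNev.counting r (TropNev.recipAdd f a)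
        / TropNev.characteristic r f) atTop (𝓝 1) := by
      have hzero : Tendsto (fun r => (TropNev.counting r (TropNev.recipAdd f a)
          - TropNev.characteristic r f) / TropNev.characteristic r f) atTop (𝓝 0) := by
        refine squeeze_zero_norm' ?_ (hT.const_div_atTop (|a| + |max (f 0) a|))
        filter_upwards [eventually_gt_atTop 0, hT.eventually_gt_atTop 0] with r hr hTr
        rw [norm_div, Real.norm_of_nonneg hTr.le, Real.norm_eq_abs]
        gcongr
        exact TropNev.abs_counting_recipAdd_sub_characteristic_le hs ha hr
      have h1 := hzero.const_add 1
      rw [add_zero] at h1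
      refine h1.congr' ?_
      filter_upwards [hT.eventually_gt_atTop 0] with r hTr
      field_simp
      ring
    have hE := ((continuous_coe_real_ereal.tendsto 1).comp hlim).limsup_eq
    unfold TropNev.deficiency
    rw [show limsup (fun r : ℝ => ((TropNev.counting r (TropNev.recipAdd f a)
      / TropNev.characteristic r f : ℝ) : EReal)) atTop = ((1 : ℝ) : EReal) from hE,
      ← EReal.coe_one, ← EReal.coe_sub, sub_self, EReal.coe_zero]
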